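/- **Setting.** Let $f\colon\mathbb R^{n_1}\times\mathbb R^{n_2}\to\mathbb R$ be locally Lipschitz continuous, $S\subset\mathbb R^{n_1}$ closed, $j\colon\mathbb R^{n_1}\times\mathbb R^{n_2}\to\mathbb R$ twice continuously differentiable and convex in $y$ for each $x$, $C\subset\mathbb R^m$ a nonempty closed convex cone, and $g\colon\mathbb R^{n_2}\to\mathbb R^m$ twice continuously differentiable and convex w.r.t. $C$, i.e. $g(\alpha y_1+(1-\alpha)y_2)-\alpha g(y_1)-(1-\alpha)g(y_2)\in C$ for all $y_1,y_2$ and $\alpha\in[0,1]$. Let $\widehat{\mathcal N}_A$ denote the regular normal cone (the polar of the Bouligand tangent cone at points of $A$, empty outside $A$), $\mathcal N_A$ the limiting normal cone, $\partial f$ the limiting subdifferential, and $D^*\Upsilon(\bar z,\bar w)(\eta)=\{\xi\mid(\xi,-\eta)\in\mathcal N_{\operatorname{gph}\Upsilon}(\bar z,\bar w)\}$ the limiting coderivative of a set-valued mapping $\Upsilon$. Consider $$\text{(BPP)}\qquad \min_{x,y} f(x,y)\quad\text{s.t.}\quad x\in S,\quad 0\in\bigcup_{\lambda\in\widehat{\mathcal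 N}_C(g(y))}\{\nabla_yj(x,y)+\nabla g(y)^\top\lambda\},$$ and the multiplier mapping $K(x,y)=\{\lambda\in\widehat{\mathcal N}_C(g(y))\mid \nabla_yj(x,y)+\nabla g(y)^\top\lambda=0\}$. **Corollary.** Let $\bar z=(\bar x,\bar y)$ be a local minimizer of (BPP), and assume that for some $\bar\lambda\in K(\bar z)$ the set-valued mapping $$\Upsilon\colon(x,y,\lambda)\rightrightarrows\bigl(x-S,\ \nabla_yj(x,y)+\nabla g(y)^\top\lambda,\ (g(y),\lambda)-\operatorname{gph}\widehat{\mathcal N}_C\bigr)$$ is metrically subregular at $((\bar x,\bar y,\bar\lambda),(0,0,(0,0)))$, i.e. there are $\kappa>0$ and a neighborhood $U$ of $(\bar x,\bar y,\bar\lambda)$ such that $\operatorname{dist}(p,\Upsilon^{-1}(0))\le\kappa\operatorname{dist}(0,\Upsilon(p))$ for all $p\in U$. Then $\bar z$ is fully explicitly M-stationary for (BPP) w.r.t. $\bar\lambda$: it is feasible, $\bar\lambda\in K(\bar z)$, and there is $\nu\in\mathbb R^{n_2}$ with $$(0,0)\in\partial f(\bar z)+\nabla^2_{yz}j(\bar z)^\top\nu+\Bigl\{\Bigl(0,\sum_{i=1}^m\bar\lambda_i\nabla^2g_i(\bar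 y)\nu\Bigr)\Bigr\}+\{0\}\times\nabla g(\bar y)^\top D^*\widehat{\mathcal N}_C(g(\bar y),\bar\lambda)(\nabla g(\bar y)\nu)+\mathcal N_S(\bar x)\times\{0\}.$$ -/

import Mathlib

open Filter Topology

noncomputable section

/-! ### Variational analysis -/

/-- The Euclidean product `E × F`: pairs, with the sum of the two inner products. -/
abbrev EProd (E F : Type*) := WithLp 2 (E × F)

/-- The element `(a, b)` of the Euclidean product. -/
abbrev epair {E F : Type*} (a : E) (b : F) : EProd E F := WithLp.toLp 2 (a, b)

section Cones

variable {E : Type*} [NormedAddCommGroup E] [InnerProductSpace ℝ E]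
variable {F : Type*} [NormedAddCommGroup F] [InnerProductSpace ℝ F]

/-- The (Bouligand) tangent cone to `A` at `z`. -/
def bouligandCone (A : Set E) (z : E) : Set E :=
  {d | ∃ (u : ℕ → E) (t : ℕ → ℝ), (∀ k, u k ∈ A) ∧ (∀ k, 0 < t k) ∧
    Tendsto u atTop (𝓝 z) ∧ Tendsto t atTop (𝓝 0) ∧
    Tendsto (fun k => (t k)⁻¹ • (u k - z)) atTop (𝓝 d)}

/-- The regular (Fréchet) normal cone to `A` at `z`: the polar of the tangent cone if `z ∈ A`,
and the empty set if `z ∉ A`. -/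
def regularNormalCone (A : Set E) (z : E) : Set E :=
  {ξ | z ∈ A ∧ ∀ d ∈ bouligandCone A z, inner ℝ ξ d ≤ 0}

/-- The limiting (Mordukhovich) normal cone to `A` at `z`. -/
def limitingNormalCone (A : Set E) (z : E) : Set E :=
  {ξ | ∃ (u : ℕ → E) (η : ℕ → E), (∀ k, u k ∈ A) ∧ Tendsto u atTop (𝓝 z) ∧
    Tendsto η atTop (𝓝 ξ) ∧ ∀ k, η k ∈ regularNormalCone A (u k)}

/-- The epigraph of a real-valued function. -/
def epigraph (φ : E → ℝ) : Set (EProd E ℝ) :=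
  {p | φ p.fst ≤ p.snd}

/-- The limiting (Mordukhovich) subdifferential of `φ` at `z`. -/
def limitingSubdifferential (φ : E → ℝ) (z : E) : Set E :=
  {ξ | epair ξ (-1) ∈ limitingNormalCone (epigraph φ) (epair z (φ z))}

/-- The graph of a set-valued mapping. -/
def gph (Υ : E → Set F) : Set (EProd E F) :=
  {p | p.snd ∈ Υ p.fst}

/-- The limiting coderivative `D^*Υ(z, w)(η)`. -/
def coderivative (Υ : E → Set F) (z : E) (w : F) (η : F) : Set E :=
  {ξ | epair ξ (-η) ∈ limitingNormalCone (gph Υ) (epair z w)}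

/-- Metric subregularity of `Υ` at `(z, w)`:
`dist(z', Υ⁻¹(w)) ≤ κ dist(w, Υ(z'))` for all `z'` close to `z`.
Distances are extended distances, so that the distance to the empty set is `∞`. -/
def MetricallySubregularAt (Υ : E → Set F) (z : E) (w : F) : Prop :=
  ∃ κ : ℝ, 0 < κ ∧ ∀ᶠ z' in 𝓝 z,
    Metric.infEDist z' {v | w ∈ Υ v} ≤ ENNReal.ofReal κ * Metric.infEDist w (Υ z')

end Cones

/-! ### The bilevel programming problem -/

/-- `ℝⁿ` with the Euclidean norm. -/
abbrev RVec (n : ℕ) := EuclideanSpace ℝ (Fin n)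

/-- The data of a bilevel programming problem: upper-level objective `f`, upper-level constraint
set `S`, lower-level objective `j`, lower-level constraint `g y ∈ C` with a nonempty closed convex
cone `C`. -/
structure BilevelData (n₁ n₂ m : ℕ) where
  /-- upper-level objective -/
  f : EProd (RVec n₁) (RVec n₂) → ℝ
  /-- upper-level constraint set -/
  S : Set (RVec n₁)
  /-- lower-level objective -/
  j : EProd (RVec n₁) (RVec n₂) → ℝ
  /-- lower-level constraint function -/
  g : RVec n₂ → RVec m
  /-- lower-level constraint cone -/
  C : ProperCone ℝ (RVec m)

namespace BilevelData

variable {n₁ n₂ m : ℕ} (P : BilevelData n₁ n₂ m)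

/-- The partial gradient `∇_y j(x, y)`. -/
def gradY (z : EProd (RVec n₁) (RVec n₂)) : RVec n₂ :=
  gradient (fun y => P.j (epair z.fst y)) z.snd

/-- `∇g(y)ᵀ λ`. -/
def jacT (y : RVec n₂) (lam : RVec m) : RVec n₂ :=
  ContinuousLinearMap.adjoint (fderiv ℝ P.g y) lam

/-- The normal cone mapping of `C`. -/
def normalC (a : RVec m) : Set (RVec m) :=
  regularNormalCone (P.C : Set (RVec m)) a

/-- The Lagrange multiplier mapping `K(x, y)` of the lower-level problem: all `λ ∈ N_C(g(y))` with
`∇_y j(x, y) + ∇g(y)ᵀ λ = 0`. -/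
def multipliers (z : EProd (RVec n₁) (RVec n₂)) : Set (RVec m) :=
  {lam | lam ∈ P.normalC (P.g z.snd) ∧ P.gradY z + P.jacT z.snd lam = 0}

/-- The feasible set of (BPP): `x ∈ S` and
`0 ∈ ⋃_{λ ∈ N_C(g(y))} {∇_y j(x, y) + ∇g(y)ᵀ λ}`. -/
def feasibleSet : Set (EProd (RVec n₁) (RVec n₂)) :=
  {z | z.fst ∈ P.S ∧ 0 ∈ ⋃ lam ∈ P.normalC (P.g z.snd), {P.gradY z + P.jacT z.snd lam}}

/-- Local minimizers of (BPP). -/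
def IsLocalMinimizer (z : EProd (RVec n₁) (RVec n₂)) : Prop :=
  z ∈ P.feasibleSet ∧ IsLocalMinOn P.f P.feasibleSet z

/-- The feasibility mapping
`(x, y, λ) ⇉ (x - S, ∇_y j(x, y) + ∇g(y)ᵀ λ, (g(y), λ) - gph N_C)`;
its argument is `((x, y), λ)`. -/
def feasibilityMap (p : EProd (EProd (RVec n₁) (RVec n₂)) (RVec m)) :
    Set (EProd (RVec n₁) (EProd (RVec n₂) (EProd (RVec m) (RVec m)))) :=
  {w | ∃ s ∈ P.S, ∃ q ∈ gph P.normalC,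
    w = epair (p.fst.fst - s)
      (epair (P.gradY p.fst + P.jacT p.fst.snd p.snd) (epair (P.g p.fst.snd) p.snd - q))}

/-- The Hessian of the `i`-th component of `g` at `y`, applied to `ν`. -/
def hessG (i : Fin m) (y ν : RVec n₂) : RVec n₂ :=
  fderiv ℝ (gradient (fun y' => P.g y' i)) y ν

/-- Fully explicit M-stationarity of `z = (x, y)` with respect to the multiplier `lam`: `z` is
feasible, `lam ∈ K(z)`, and there is `ν` with
`(0, 0) ∈ ∂f(z) + ∇²_{yz} j(z)ᵀ ν + {(0, ∑ᵢ λᵢ ∇²gᵢ(y) ν)}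
  + {0} × ∇g(y)ᵀ D^*N_C(g(y), λ)(∇g(y) ν) + N_S(x) × {0}`. -/
def FullyExplicitlyMStationary (z : EProd (RVec n₁) (RVec n₂)) (lam : RVec m) : Prop :=
  z ∈ P.feasibleSet ∧ lam ∈ P.multipliers z ∧
    ∃ ν : RVec n₂, ∃ ξ ∈ limitingSubdifferential P.f z,
      ∃ μ ∈ coderivative P.normalC (P.g z.snd) lam (fderiv ℝ P.g z.snd ν),
        ∃ σ ∈ limitingNormalCone P.S z.fst,
          ξ + ContinuousLinearMap.adjoint (fderiv ℝ P.gradY z) ν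
            + epair 0 (∑ i, lam i • P.hessG i z.snd ν)
            + epair 0 (P.jacT z.snd μ)
            + epair σ 0 = 0

end BilevelData

end

/-! ### Fermat's rule and limit tools -/

section OptimalityConditions

variable {E : Type*} [NormedAddCommGroup E] [InnerProductSpace ℝ E]

/-! Treat the multiplier as a variable: with p = ((x, y), λ), the constraint becomes G p ∈ Ω, where
G is `feasibilityFun` and Ω = S × ({0} × gph N_C). The objective ignores λ, so (x̄, ȳ, λ̄) is a
local minimizer of the lifted problem. Metric subregularity and the Lipschitz property of f make the
penalty f + M‖G p - q‖, q ∈ Ω, exact near the reference point (`exists_exact_penalty`).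

A multiplier rule for such a penalty (`exists_multiplier`) is proved without subdifferential
calculus. The variables are decoupled, the norm is smoothed, and Fermat's rule is applied in each
block at a minimizer over a compact set (`exists_approximate_multiplier`). The penalty factor M
bounds the multipliers, so a subsequence converges to ξ ∈ ∂f and η ∈ N_Ω with (ξ, 0) + ∇Gᵀη = 0.

Splitting η along the product Ω and testing this equation in the directions of λ and of (x, y)
yields the coderivative condition and the stationarity equation (`inner_fderiv_feasibilityFun`). -/

/-- Fermat's rule for a smooth function on a set. -/
theorem mem_regularNormalCone_of_isLocalMinOn {A : Set E} {h : E → ℝ} {h' : E →L[ℝ] ℝ} {u ζ : E}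
    (hu : u ∈ A) (hmin : IsLocalMinOn h A u) (hd : HasFDerivAt h h' u)
    (hζ : ∀ d, inner ℝ ζ d = -h' d) : ζ ∈ regularNormalCone A u := by
  refine ⟨hu, ?_⟩
  rintro d ⟨w, t, hw, ht, hwu, -, hd'⟩
  have h0 : Tendsto (fun k => w k - u) atTop (𝓝 0) := by
    simpa using hwu.sub_const u
  have hlim := (hd.hasFDerivWithinAt (s := A)).lim h0
    (Eventually.of_forall fun k => by simpa using hw k) hd'
  have hev : ∀ᶠ k in atTop, h u ≤ h (w k) :=
    (tendsto_nhdsWithin_iff.2 ⟨hwu, Eventually.of_forall hw⟩).eventually hmin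
  have : 0 ≤ h' d := by
    refine ge_of_tendsto hlim (hev.mono fun k hk => ?_)
    have : u + (w k - u) = w k := by abel
    rw [this]
    exact mul_nonneg (inv_nonneg.2 (ht k).le) (sub_nonneg.2 hk)
  rw [hζ]
  linarith

theorem hasFDerivAt_half_norm_sub_sq (c u : E) :
    HasFDerivAt (fun v => 1 / 2 * ‖v - c‖ ^ 2) (innerSL ℝ (u - c)) u := by
  refine ((((hasFDerivAt_id u).sub_const c).norm_sq).const_mul (1 / 2)).congr_fderiv ?_
  ext v
  simp

/-- The derivative of the smoothed norm `√(‖w‖² + s²)`. -/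
theorem hasFDerivAt_sqrt_norm_sq_add {s : ℝ} (hs : 0 < s) (w : E) :
    HasFDerivAt (fun w : E => √(‖w‖ ^ 2 + s ^ 2))
      (innerSL ℝ ((√(‖w‖ ^ 2 + s ^ 2))⁻¹ • w)) w := by
  have hpos : 0 < ‖w‖ ^ 2 + s ^ 2 := by positivity
  refine ((((hasFDerivAt_id w).norm_sq).add_const (s ^ 2)).sqrt hpos.ne').congr_fderiv ?_
  ext v
  simp
  ring

theorem eventually_norm_sub_le {X : Type*} [NormedAddCommGroup X] {c u : X} {ρ : ℝ}
    (h : ‖u - c‖ < ρ) : ∀ᶠ v in 𝓝 u, ‖v - c‖ ≤ ρ := by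
  have : Continuous fun v : X => ‖v - c‖ := by fun_prop
  exact (this.continuousAt.eventually (gt_mem_nhds h)).mono fun v hv => hv.le

theorem tendsto_of_norm_sub_lt_one_div {X : Type*} [NormedAddCommGroup X] {c : X} {u : ℕ → X}
    (h : ∀ k, ‖u k - c‖ < 1 / ((k : ℝ) + 1)) : Tendsto u atTop (𝓝 c) :=
  tendsto_iff_norm_sub_tendsto_zero.2 (squeeze_zero (fun _ => norm_nonneg _)
    (fun k => (h k).le) tendsto_one_div_add_atTop_nhds_zero_nat)

theorem tendsto_epair {ι X Y : Type*} [NormedAddCommGroup X] [NormedAddCommGroup Y]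
    {l : Filter ι} {u : ι → X} {w : ι → Y} {c : X} {e : Y} (hu : Tendsto u l (𝓝 c))
    (hw : Tendsto w l (𝓝 e)) : Tendsto (fun k => epair (u k) (w k)) l (𝓝 (epair c e)) :=
  ((WithLp.prod_continuous_toLp 2 _ _).tendsto _).comp (hu.prodMk_nhds hw)

theorem tendsto_clm_apply {ι X Y : Type*} [NormedAddCommGroup X] [NormedSpace ℝ X]
    [NormedAddCommGroup Y] [NormedSpace ℝ Y] {l : Filter ι} {T : ι → X →L[ℝ] Y} {T₀ : X →L[ℝ] Y}
    {w : ι → X} {w₀ : X} (hT : Tendsto T l (𝓝 T₀)) (hw : Tendsto w l (𝓝 w₀)) :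
    Tendsto (fun k => T k (w k)) l (𝓝 (T₀ w₀)) :=
  (isBoundedBilinearMap_apply.continuous.tendsto (T₀, w₀)).comp (hT.prodMk_nhds hw)

theorem tendsto_adjoint {ι X Y : Type*} [NormedAddCommGroup X] [InnerProductSpace ℝ X]
    [CompleteSpace X] [NormedAddCommGroup Y] [InnerProductSpace ℝ Y] [CompleteSpace Y]
    {l : Filter ι} {T : ι → X →L[ℝ] Y} {T₀ : X →L[ℝ] Y} (hT : Tendsto T l (𝓝 T₀)) :
    Tendsto (fun k => ContinuousLinearMap.adjoint (T k)) l
      (𝓝 (ContinuousLinearMap.adjoint T₀)) :=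
  ((ContinuousLinearMap.adjoint (𝕜 := ℝ) (E := X) (F := Y)).continuous.tendsto T₀).comp hT

end OptimalityConditions

/-! ### Multiplier rule for exact penalties -/

section Penalty

variable {Z L W : Type*}
  [NormedAddCommGroup Z] [InnerProductSpace ℝ Z] [FiniteDimensional ℝ Z]
  [NormedAddCommGroup L] [InnerProductSpace ℝ L] [FiniteDimensional ℝ L]
  [NormedAddCommGroup W] [InnerProductSpace ℝ W] [FiniteDimensional ℝ W]

/-- The smooth penalty function is bounded below by its value at the reference point up to a small
error, which forces approximate minimizers to be close to that point. -/
theorem penalty_bound {k K M a b d Fz Fp F₀ w s : ℝ} (hk : 4 ≤ k)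
    (hz : Fp - K * d ≤ Fz) (hp : F₀ ≤ Fp + M * w) (hM : 0 ≤ M) (hw : w ≤ s)
    (hle : Fz + k / 2 * d ^ 2 + M * s + 1 / 2 * a ^ 2 + 1 / 2 * b ^ 2 ≤ F₀ + M * (1 / k)) :
    d ^ 2 ≤ 2 * (M + K ^ 2) / k ∧ a ^ 2 ≤ 2 * (M + K ^ 2) / k ∧
      b ^ 2 ≤ 2 * (M + K ^ 2) / k := by
  have hk0 : 0 < k := by linarith
  -- Completing the square: half of the coupling term absorbs the Lipschitz loss K d at cost K² / k.
  have h1 : 0 ≤ k / 4 * d ^ 2 + K ^ 2 / k - K * d := by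
    have : k / 4 * d ^ 2 + K ^ 2 / k - K * d = (k / 2 * d - K) ^ 2 / k := by
      field_simp
      ring
    rw [this]
    positivity
  have h2 : M * w ≤ M * s := mul_le_mul_of_nonneg_left hw hM
  have h3 : 2 * (M + K ^ 2) / k = 2 * (M * (1 / k) + K ^ 2 / k) := by
    field_simp
  have h4 : 1 / 2 * d ^ 2 ≤ k / 4 * d ^ 2 :=
    mul_le_mul_of_nonneg_right (by linarith) (sq_nonneg d)
  rw [h3]
  refine ⟨?_, ?_, ?_⟩ <;> nlinarith [sq_nonneg a, sq_nonneg b, sq_nonneg d]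

/-- Approximate multiplier rule for a problem with an exact penalty function. -/
theorem exists_approximate_multiplier {F : Z → ℝ} {G : EProd Z L → W} {Ω : Set W}
    (hΩ : IsClosed Ω) (hF : LocallyLipschitz F) (hG : ContDiff ℝ 1 G) {p₀ : EProd Z L}
    (hp₀ : G p₀ ∈ Ω) {M r : ℝ} (hM : 0 ≤ M) (hr : 0 < r)
    (hpen : ∀ p, ‖p - p₀‖ ≤ r → ∀ q ∈ Ω, ‖q - G p₀‖ ≤ r →
      F p₀.fst ≤ F p.fst + M * ‖G p - q‖) {ε : ℝ} (hε : 0 < ε) :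
    ∃ (z : Z) (p : EProd Z L) (q : W) (ξ : Z) (η : W),
      ‖z - p₀.fst‖ < ε ∧ ‖p - p₀‖ < ε ∧ q ∈ Ω ∧ ‖q - G p₀‖ < ε ∧
      epair ξ (-1) ∈ regularNormalCone (epigraph F) (epair z (F z)) ∧ ‖η‖ ≤ M ∧
      η - (q - G p₀) ∈ regularNormalCone Ω q ∧
      epair ξ 0 + ContinuousLinearMap.adjoint (fderiv ℝ G p) η + (p - p₀) = 0 := by
  have hfst : ∀ v : EProd Z L, ‖v.fst‖ ≤ ‖v‖ := fun v => WithLp.norm_fst_le _ v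
  obtain ⟨K, t, ht, hK⟩ := hF p₀.fst
  obtain ⟨ρ₀, hρ₀, hball⟩ := Metric.nhds_basis_closedBall.mem_iff.1 ht
  obtain ⟨ρ, hρ, hρr, hρρ⟩ : ∃ ρ, 0 < ρ ∧ ρ ≤ r ∧ ρ ≤ ρ₀ :=
    ⟨min r ρ₀, lt_min hr hρ₀, min_le_left _ _, min_le_right _ _⟩
  obtain ⟨δ, hδ, hδρ, hδε⟩ : ∃ δ, 0 < δ ∧ 2 * δ ≤ ρ ∧ 2 * δ ≤ ε :=
    ⟨min ρ ε / 2, by positivity, by linarith [min_le_left ρ ε], by linarith [min_le_right ρ ε]⟩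
  -- The fraction brings the bound of `penalty_bound` down to δ²; the summand 4 makes this strict
  -- and gives 4 ≤ k.
  set k : ℝ := 4 + 2 * (M + (K : ℝ) ^ 2) / δ ^ 2 with hkdef
  have hk4 : 4 ≤ k := by
    have : 0 ≤ 2 * (M + (K : ℝ) ^ 2) / δ ^ 2 := by positivity
    linarith
  have hk0 : 0 < k := by linarith
  have hkδ : 2 * (M + (K : ℝ) ^ 2) / k < δ ^ 2 := by
    have h1 : δ ^ 2 * k = δ ^ 2 * 4 + 2 * (M + (K : ℝ) ^ 2) := by
      rw [hkdef]
      field_simp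
    have h2 : 0 < δ ^ 2 * 4 := by positivity
    rw [div_lt_iff₀ hk0]
    linarith
  set s : EProd Z L → W → ℝ := fun p q => √(‖G p - q‖ ^ 2 + (1 / k) ^ 2) with hs
  -- A copy z of `p.fst` carries the nonsmooth F, and q carries Ω; every coupling between the blocks
  -- is smooth. The last two squares localize at the reference point.
  set Φ : Z × EProd Z L × W → ℝ := fun x =>
    F x.1 + k / 2 * ‖x.1 - x.2.1.fst‖ ^ 2 + M * s x.2.1 x.2.2 + 1 / 2 * ‖x.2.1 - p₀‖ ^ 2
      + 1 / 2 * ‖x.2.2 - G p₀‖ ^ 2 with hΦ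
  have hcont : Continuous Φ := by
    have h1 := hF.continuous
    have h2 := hG.continuous
    have h3 : Continuous fun x : Z × EProd Z L × W => x.2.1.fst :=
      (WithLp.fstL 2 ℝ Z L).continuous.comp (by fun_prop)
    fun_prop
  have hcomp : IsCompact (Metric.closedBall p₀.fst ρ ×ˢ
      (Metric.closedBall p₀ ρ ×ˢ (Metric.closedBall (G p₀) ρ ∩ Ω))) :=
    (isCompact_closedBall _ _).prod
      ((isCompact_closedBall _ _).prod ((isCompact_closedBall _ _).inter_right hΩ))
  have hmem₀ : (p₀.fst, p₀, G p₀) ∈ Metric.closedBall p₀.fst ρ ×ˢ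
      (Metric.closedBall p₀ ρ ×ˢ (Metric.closedBall (G p₀) ρ ∩ Ω)) :=
    ⟨Metric.mem_closedBall_self hρ.le, Metric.mem_closedBall_self hρ.le,
      Metric.mem_closedBall_self hρ.le, hp₀⟩
  obtain ⟨⟨z, p, q⟩, ⟨hz, hp, hq, hqΩ⟩, hmin⟩ :=
    hcomp.exists_isMinOn ⟨_, hmem₀⟩ hcont.continuousOn
  simp only [mem_closedBall_iff_norm] at hz hp hq
  have hmin' : ∀ z' p' q', ‖z' - p₀.fst‖ ≤ ρ → ‖p' - p₀‖ ≤ ρ → ‖q' - G p₀‖ ≤ ρ → q' ∈ Ω →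
      Φ (z, p, q) ≤ Φ (z', p', q') := fun z' p' q' h1 h2 h3 h4 =>
    hmin ⟨mem_closedBall_iff_norm.2 h1, mem_closedBall_iff_norm.2 h2,
      mem_closedBall_iff_norm.2 h3, h4⟩
  have hpf : ‖p.fst - p₀.fst‖ ≤ ‖p - p₀‖ := hfst (p - p₀)
  have hws : ‖G p - q‖ ≤ s p q := by
    refine Real.le_sqrt_of_sq_le ?_
    have : 0 ≤ (1 / k) ^ 2 := by positivity
    linarith
  obtain ⟨hd, ha, hb⟩ := penalty_bound (F₀ := F p₀.fst) (Fp := F p.fst) (Fz := F z)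
    (d := ‖z - p.fst‖) (a := ‖p - p₀‖) (b := ‖q - G p₀‖) (K := K) hk4
    (by
      have hz' : z ∈ t := hball (mem_closedBall_iff_norm.2 (hz.trans hρρ))
      have hp' : p.fst ∈ t := hball (mem_closedBall_iff_norm.2 ((hpf.trans hp).trans hρρ))
      have := hK.dist_le_mul _ hp' _ hz'
      rw [Real.dist_eq, dist_comm, dist_eq_norm] at this
      linarith [le_abs_self (F p.fst - F z)])
    (hpen p (hp.trans hρr) q hqΩ (hq.trans hρr)) hM hws
    (by
      have := hmin' p₀.fst p₀ (G p₀) (by simpa using hρ.le) (by simpa using hρ.le)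
        (by simpa using hρ.le) hp₀
      simp only [hΦ] at this
      have hs₀ : s p₀ (G p₀) = 1 / k := by
        simp only [hs, sub_self, norm_zero]
        rw [zero_pow two_ne_zero, zero_add, Real.sqrt_sq (by positivity)]
      rw [hs₀] at this
      simpa using this)
  -- Since 2δ ≤ ρ, the minimizer lies inside all three balls, so only q ∈ Ω remains as a constraint.
  have hdδ : ‖z - p.fst‖ < δ := lt_of_pow_lt_pow_left₀ 2 hδ.le (hd.trans_lt hkδ)
  have haδ : ‖p - p₀‖ < δ := lt_of_pow_lt_pow_left₀ 2 hδ.le (ha.trans_lt hkδ)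
  have hbδ : ‖q - G p₀‖ < δ := lt_of_pow_lt_pow_left₀ 2 hδ.le (hb.trans_lt hkδ)
  have hzδ : ‖z - p₀.fst‖ < 2 * δ := by
    have := norm_sub_le_norm_sub_add_norm_sub z p.fst p₀.fst
    linarith
  have hspos : 0 < 1 / k := by positivity
  set η : W := M • ((s p q)⁻¹ • (G p - q)) with hη
  have hs0 : 0 < s p q := Real.sqrt_pos.2 (by positivity)
  refine ⟨z, p, q, -(k • (z - p.fst)), η, by linarith, by linarith, hqΩ, by linarith, ?_, ?_,
    ?_, ?_⟩
  -- Block z: F is replaced by the height coordinate on its epigraph, which leaves a smooth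
  -- objective; its negative gradient is (ξ, -1).
  · refine mem_regularNormalCone_of_isLocalMinOn
      (h := fun e : EProd Z ℝ => e.snd + k * (1 / 2 * ‖e.fst - p.fst‖ ^ 2))
      (h' := WithLp.sndL 2 ℝ Z ℝ + k • (innerSL ℝ (z - p.fst)).comp (WithLp.fstL 2 ℝ Z ℝ))
      (by simp [epigraph]) ?_ ?_ ?_
    · have hz' : ∀ᶠ e : EProd Z ℝ in 𝓝 (epair z (F z)), ‖e.fst - p₀.fst‖ ≤ ρ :=
        ((WithLp.fstL 2 ℝ Z ℝ).continuous.tendsto (epair z (F z))).eventually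
          (eventually_norm_sub_le (by simpa using by linarith))
      filter_upwards [hz'.filter_mono nhdsWithin_le_nhds, self_mem_nhdsWithin] with e he heF
      have h1 := hmin' e.fst p q he hp hq hqΩ
      simp only [hΦ] at h1
      have h2 : F e.fst ≤ e.snd := heF
      simp only [WithLp.toLp_fst, WithLp.toLp_snd]
      linarith
    · exact (WithLp.sndL 2 ℝ Z ℝ).hasFDerivAt.add
        (((hasFDerivAt_half_norm_sub_sq p.fst z).comp (epair z (F z))
          (WithLp.fstL 2 ℝ Z ℝ).hasFDerivAt).const_mul k)
    · intro d
      simp [inner_smul_left, inner_sub_left]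
  · rw [hη, norm_smul, norm_smul, Real.norm_of_nonneg hM, norm_inv, Real.norm_of_nonneg hs0.le]
    refine mul_le_of_le_one_right hM ?_
    rw [inv_mul_le_iff₀ hs0, mul_one]
    exact hws
  -- Block q: minimality over Ω.
  · refine mem_regularNormalCone_of_isLocalMinOn
      (h := fun q' : W => M * s p q' + 1 / 2 * ‖q' - G p₀‖ ^ 2)
      (h' := M • (innerSL ℝ ((s p q)⁻¹ • (G p - q))).comp (-ContinuousLinearMap.id ℝ W)
        + innerSL ℝ (q - G p₀)) hqΩ ?_ ?_ ?_
    · filter_upwards [(eventually_norm_sub_le (by linarith : ‖q - G p₀‖ < ρ)).filter_mono nhdsWithin_le_nhds,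
        self_mem_nhdsWithin] with q' hq' hq'Ω
      have h1 := hmin' z p q' hz hp hq' hq'Ω
      simp only [hΦ] at h1
      linarith
    · exact (((hasFDerivAt_sqrt_norm_sq_add hspos (G p - q)).comp q
        ((hasFDerivAt_id q).const_sub (G p))).const_mul M).add
          (hasFDerivAt_half_norm_sub_sq (G p₀) q)
    · intro d
      simp [hη, inner_smul_left, inner_sub_left]
      ring
  -- Block p is unconstrained. The coupling term has gradient k(p.fst - z) in the first component,
  -- which is the same ξ as in block z.
  · have hlm : IsLocalMin (fun p' : EProd Z L => k * (1 / 2 * ‖p'.fst - z‖ ^ 2) + M * s p' q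
        + 1 / 2 * ‖p' - p₀‖ ^ 2) p := by
      filter_upwards [eventually_norm_sub_le (by linarith : ‖p - p₀‖ < ρ)] with p' hp'
      have h1 := hmin' z p' q hz hp' hq hqΩ
      simp only [hΦ, norm_sub_rev z] at h1
      linarith
    have hder := (((((hasFDerivAt_half_norm_sub_sq z p.fst).comp p
      (WithLp.fstL 2 ℝ Z L).hasFDerivAt).const_mul k).add
      (((hasFDerivAt_sqrt_norm_sq_add hspos (G p - q)).comp p
        ((hG.differentiable one_ne_zero p).hasFDerivAt.sub_const q)).const_mul M))).add
          (hasFDerivAt_half_norm_sub_sq p₀ p)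
    have hzero := hlm.hasFDerivAt_eq_zero hder
    refine ext_inner_right ℝ fun v => ?_
    have := DFunLike.congr_fun hzero v
    simp at this
    simp [hη, hs, inner_add_left, inner_smul_left, ContinuousLinearMap.adjoint_inner_left,
      inner_sub_left] at this ⊢
    linarith

/-- Multiplier rule for a problem with an exact penalty function. -/
theorem exists_multiplier {F : Z → ℝ} {G : EProd Z L → W} {Ω : Set W}
    (hΩ : IsClosed Ω) (hF : LocallyLipschitz F) (hG : ContDiff ℝ 1 G) {p₀ : EProd Z L}
    (hp₀ : G p₀ ∈ Ω) {M r : ℝ} (hM : 0 ≤ M) (hr : 0 < r)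
    (hpen : ∀ p, ‖p - p₀‖ ≤ r → ∀ q ∈ Ω, ‖q - G p₀‖ ≤ r →
      F p₀.fst ≤ F p.fst + M * ‖G p - q‖) :
    ∃ ξ ∈ limitingSubdifferential F p₀.fst, ∃ η ∈ limitingNormalCone Ω (G p₀),
      epair ξ 0 + ContinuousLinearMap.adjoint (fderiv ℝ G p₀) η = 0 := by
  choose z p q ξ η hz hp hqΩ hq hξ hη hηN heq using fun k : ℕ =>
    exists_approximate_multiplier hΩ hF hG hp₀ hM hr hpen (Nat.one_div_pos_of_nat (α := ℝ) (n := k))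
  obtain ⟨η₀, -, φ, hφ, hη₀⟩ := (isCompact_closedBall (0 : W) M).tendsto_subseq
    (x := η) fun k => by simpa using hη k
  have hz₀ := (tendsto_of_norm_sub_lt_one_div hz).comp hφ.tendsto_atTop
  have hp₀' := (tendsto_of_norm_sub_lt_one_div hp).comp hφ.tendsto_atTop
  have hq₀ := (tendsto_of_norm_sub_lt_one_div hq).comp hφ.tendsto_atTop
  have hadj : Tendsto (fun k => ContinuousLinearMap.adjoint (fderiv ℝ G (p (φ k))) (η (φ k)))
      atTop (𝓝 (ContinuousLinearMap.adjoint (fderiv ℝ G p₀) η₀)) :=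
    tendsto_clm_apply
      (tendsto_adjoint (((hG.continuous_fderiv one_ne_zero).tendsto p₀).comp hp₀')) hη₀
  -- Convergence of ξ is read off from the multiplier equation, so the subgradients need no separate
  -- bound.
  have hpair : Tendsto (fun k => epair (ξ (φ k)) (0 : L)) atTop
      (𝓝 (-ContinuousLinearMap.adjoint (fderiv ℝ G p₀) η₀)) := by
    have h := (hadj.add (hp₀'.sub_const p₀)).neg
    simp only [sub_self, add_zero] at h
    refine h.congr fun k => ?_
    have := heq (φ k)
    rw [add_assoc] at this
    exact (eq_neg_of_add_eq_zero_left this).symm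
  set ξ₀ : Z := (-ContinuousLinearMap.adjoint (fderiv ℝ G p₀) η₀).fst with hξ₀
  have hξlim : Tendsto (fun k => ξ (φ k)) atTop (𝓝 ξ₀) :=
    ((WithLp.fstL 2 ℝ Z L).continuous.tendsto _).comp hpair
  refine ⟨ξ₀, ⟨fun k => epair (z (φ k)) (F (z (φ k))), fun k => epair (ξ (φ k)) (-1),
    fun k => by simp [epigraph], ?_, ?_, fun k => hξ (φ k)⟩, η₀,
    ⟨fun k => q (φ k), fun k => η (φ k) - (q (φ k) - G p₀), fun k => hqΩ _, hq₀, ?_,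
      fun k => hηN _⟩, ?_⟩
  · exact tendsto_epair hz₀ ((hF.continuous.tendsto _).comp hz₀)
  · exact tendsto_epair hξlim tendsto_const_nhds
  · simpa using hη₀.sub (hq₀.sub_const (G p₀))
  · have := tendsto_nhds_unique (tendsto_epair hξlim (tendsto_const_nhds (x := (0 : L)))) hpair
    rw [this, neg_add_cancel]

end Penalty

/-! ### Normal cones of products and of convex sets -/

theorem eprod_ext {E F : Type*} {p q : EProd E F} (h₁ : p.fst = q.fst) (h₂ : p.snd = q.snd) :
    p = q :=
  WithLp.ofLp_injective 2 (Prod.ext h₁ h₂)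

section NormalCones

variable {E : Type*} [NormedAddCommGroup E] [InnerProductSpace ℝ E]
variable {F : Type*} [NormedAddCommGroup F] [InnerProductSpace ℝ F]

/-- The product of two sets as a subset of the Euclidean product. -/
def eprodSet (A : Set E) (B : Set F) : Set (EProd E F) :=
  {p | p.fst ∈ A ∧ p.snd ∈ B}

theorem IsClosed.eprodSet {A : Set E} {B : Set F} (hA : IsClosed A) (hB : IsClosed B) :
    IsClosed (eprodSet A B) :=
  (hA.preimage (WithLp.fstL 2 ℝ E F).continuous).inter
    (hB.preimage (WithLp.sndL 2 ℝ E F).continuous)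

/-- Freezing one component pads a tangent direction of a factor with zero to a tangent direction of
the product; test the polar inequality there. -/
theorem regularNormalCone_eprodSet {A : Set E} {B : Set F} {p ζ : EProd E F}
    (h : ζ ∈ regularNormalCone (eprodSet A B) p) :
    ζ.fst ∈ regularNormalCone A p.fst ∧ ζ.snd ∈ regularNormalCone B p.snd := by
  obtain ⟨⟨hA, hB⟩, hpol⟩ := h
  refine ⟨⟨hA, ?_⟩, ⟨hB, ?_⟩⟩
  · rintro d ⟨u, t, hu, ht, hup, ht0, hd⟩
    have hmem : epair d (0 : F) ∈ bouligandCone (eprodSet A B) p := by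
      refine ⟨fun k => epair (u k) p.snd, t, fun k => ⟨hu k, hB⟩, ht,
        tendsto_epair hup tendsto_const_nhds, ht0, ?_⟩
      refine (tendsto_epair hd (tendsto_const_nhds (x := (0 : F)))).congr fun k => ?_
      refine eprod_ext ?_ ?_ <;> simp
    simpa using hpol _ hmem
  · rintro d ⟨u, t, hu, ht, hup, ht0, hd⟩
    have hmem : epair (0 : E) d ∈ bouligandCone (eprodSet A B) p := by
      refine ⟨fun k => epair p.fst (u k), t, fun k => ⟨hA, hu k⟩, ht,
        tendsto_epair tendsto_const_nhds hup, ht0, ?_⟩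
      refine (tendsto_epair (tendsto_const_nhds (x := (0 : E))) hd).congr fun k => ?_
      refine eprod_ext ?_ ?_ <;> simp
    simpa using hpol _ hmem

theorem limitingNormalCone_eprodSet {A : Set E} {B : Set F} {p ζ : EProd E F}
    (h : ζ ∈ limitingNormalCone (eprodSet A B) p) :
    ζ.fst ∈ limitingNormalCone A p.fst ∧ ζ.snd ∈ limitingNormalCone B p.snd := by
  obtain ⟨u, η, hu, hup, hη, hreg⟩ := h
  exact ⟨⟨fun k => (u k).fst, fun k => (η k).fst, fun k => (hu k).1,
      ((WithLp.fstL 2 ℝ E F).continuous.tendsto _).comp hup,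
      ((WithLp.fstL 2 ℝ E F).continuous.tendsto _).comp hη,
      fun k => (regularNormalCone_eprodSet (hreg k)).1⟩,
    ⟨fun k => (u k).snd, fun k => (η k).snd, fun k => (hu k).2,
      ((WithLp.sndL 2 ℝ E F).continuous.tendsto _).comp hup,
      ((WithLp.sndL 2 ℝ E F).continuous.tendsto _).comp hη,
      fun k => (regularNormalCone_eprodSet (hreg k)).2⟩⟩

/-- For a convex set, the regular normal cone is the normal cone of convex analysis. -/
theorem Convex.mem_regularNormalCone_iff {A : Set E} (hA : Convex ℝ A) {z ξ : E} :
    ξ ∈ regularNormalCone A z ↔ z ∈ A ∧ ∀ c ∈ A, inner ℝ ξ (c - z) ≤ 0 := by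
  refine and_congr_right fun hz => ⟨fun h c hc => h _ ?_, fun h => ?_⟩
  · have ht := tendsto_one_div_add_atTop_nhds_zero_nat (𝕜 := ℝ)
    refine ⟨fun k => z + (1 / ((k : ℝ) + 1)) • (c - z), fun k => 1 / ((k : ℝ) + 1), fun k => ?_,
      fun k => Nat.one_div_pos_of_nat, ?_, ht, ?_⟩
    · refine hA.add_smul_sub_mem hz hc ⟨Nat.one_div_pos_of_nat.le, ?_⟩
      rw [div_le_one (by positivity)]
      linarith [(Nat.cast_nonneg k : (0 : ℝ) ≤ k)]
    · simpa using (ht.smul_const (c - z)).const_add z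
    · refine tendsto_const_nhds.congr fun k => ?_
      have : (1 / ((k : ℝ) + 1)) ≠ 0 := Nat.one_div_pos_of_nat.ne'
      rw [add_sub_cancel_left, inv_smul_smul₀ this]
  · rintro d ⟨u, t, hu, ht, -, -, hd⟩
    refine le_of_tendsto ((continuous_const.inner continuous_id).tendsto d |>.comp hd)
      (Eventually.of_forall fun k => ?_)
    simp only [Function.comp_apply, id_eq, inner_smul_right]
    exact mul_nonpos_of_nonneg_of_nonpos (inv_nonneg.2 (ht k).le) (h _ (hu k))

/-- By convexity, membership is a family of inequalities continuous in (z, ξ), hence stable under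
limits. This makes Ω closed. -/
theorem isClosed_gph_regularNormalCone {A : Set E} (hA : Convex ℝ A) (hc : IsClosed A) :
    IsClosed (gph (regularNormalCone A)) := by
  have h1 := (WithLp.fstL 2 ℝ E E).continuous
  have h2 := (WithLp.sndL 2 ℝ E E).continuous
  have : gph (regularNormalCone A) = {p : EProd E E | p.fst ∈ A} ∩
      ⋂ c ∈ A, {p : EProd E E | inner ℝ p.snd (c - p.fst) ≤ 0} := by
    ext p
    simp [gph, hA.mem_regularNormalCone_iff]
  rw [this]
  refine (hc.preimage h1).inter (isClosed_biInter fun c _ => ?_)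
  exact isClosed_le (h2.inner (continuous_const.sub h1)) continuous_const

/-! ### Exact penalization from subregularity -/

/-- A local minimizer of a Lipschitz function under a subregular constraint is a local minimizer of
an exact penalty function. -/
theorem exists_exact_penalty {L W : Type*} [NormedAddCommGroup L] [InnerProductSpace ℝ L]
    [NormedAddCommGroup W] {φ : E → ℝ} {G : EProd E L → W} {Ω : Set W} {D : Set (EProd E L)}
    {p₀ : EProd E L} {κ : ℝ} (hφ : LocallyLipschitz φ) (hG : ContinuousAt G p₀) (hκ : 0 < κ)
    (hmin : ∀ᶠ p in 𝓝 p₀, p ∈ D → φ p₀.fst ≤ φ p.fst)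
    (hsub : ∀ᶠ p in 𝓝 p₀, ∀ q ∈ Ω, Metric.infEDist p D ≤ ENNReal.ofReal (κ * ‖G p - q‖)) :
    ∃ M r : ℝ, 0 ≤ M ∧ 0 < r ∧ ∀ p, ‖p - p₀‖ ≤ r → ∀ q ∈ Ω, ‖q - G p₀‖ ≤ r →
      φ p₀.fst ≤ φ p.fst + M * ‖G p - q‖ := by
  obtain ⟨K, t, ht, hK⟩ := hφ p₀.fst
  have ht' : ∀ᶠ p : EProd E L in 𝓝 p₀, p.fst ∈ t :=
    (WithLp.fstL 2 ℝ E L).continuous.tendsto p₀ ht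
  obtain ⟨ρ, hρ, hball⟩ := Metric.eventually_nhds_iff.1 (ht'.and (hmin.and hsub))
  obtain ⟨τ, hτ, hGτ⟩ := Metric.continuousAt_iff.1 hG (ρ / (8 * κ)) (by positivity)
  -- With these radii κ‖G p - q‖ ≤ ρ/4, so a nearly closest point of D to p stays in the ρ-ball,
  -- where minimality and the Lipschitz bound hold.
  refine ⟨K * κ, min (min (ρ / 4) (τ / 2)) (ρ / (8 * κ)), by positivity, by positivity, ?_⟩
  intro p hp q hq hqr
  obtain ⟨⟨hpρ, hpτ⟩, -⟩ := (le_min_iff.1 hp).imp_left le_min_iff.1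
  have hqκ := (le_min_iff.1 hqr).2
  rw [← dist_eq_norm] at hpρ hpτ
  obtain ⟨hpt, -, hps⟩ := hball (y := p) (by linarith)
  have hw : κ * ‖G p - q‖ ≤ ρ / 4 := by
    have h1 := hGτ (x := p) (by linarith)
    rw [dist_eq_norm] at h1
    have h2 := norm_sub_le_norm_sub_add_norm_sub (G p) (G p₀) q
    rw [norm_sub_rev (G p₀)] at h2
    calc κ * ‖G p - q‖ ≤ κ * (ρ / (8 * κ) + ρ / (8 * κ)) := by gcongr; linarith
      _ = ρ / 4 := by field_simp; ring
  -- The slack δ is needed because the distance to D need not be attained.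
  refine le_of_forall_pos_le_add fun δ hδ => ?_
  obtain ⟨δ', hδ', hδδ, hδρ⟩ : ∃ δ', 0 < δ' ∧ K * δ' ≤ δ ∧ δ' ≤ ρ / 4 := by
    refine ⟨min (δ / (K + 1)) (ρ / 4), by positivity, ?_, min_le_right _ _⟩
    calc K * min (δ / (K + 1)) (ρ / 4) ≤ (K + 1) * (δ / ((K : ℝ) + 1)) := by
          gcongr
          · linarith
          · exact min_le_left _ _
      _ = δ := by field_simp
  have hlt : Metric.infEDist p D < ENNReal.ofReal (κ * ‖G p - q‖ + δ') :=
    (hps q hq).trans_lt ((ENNReal.ofReal_lt_ofReal_iff (by positivity)).2 (by linarith))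
  obtain ⟨p', hp'D, hp'⟩ := Metric.infEDist_lt_iff.1 hlt
  rw [edist_dist, ENNReal.ofReal_lt_ofReal_iff (by positivity)] at hp'
  obtain ⟨hp't, hp'min, -⟩ := hball (y := p') (by
    have := dist_triangle_left p' p₀ p
    linarith)
  have h1 := hK.dist_le_mul _ hp't _ hpt
  rw [Real.dist_eq] at h1
  have h2 : dist p'.fst p.fst ≤ dist p p' := by
    rw [dist_comm p]
    exact WithLp.dist_fst_le p' p
  have h3 : (K : ℝ) * dist p'.fst p.fst ≤ K * (κ * ‖G p - q‖ + δ') := by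
    gcongr
    linarith
  linarith [hp'min hp'D, le_abs_self (φ p'.fst - φ p.fst)]

end NormalCones

/-! ### Smoothness and differentiation tools -/

theorem ContDiff.epair {X E F : Type*} [NormedAddCommGroup X] [NormedSpace ℝ X]
    [NormedAddCommGroup E] [InnerProductSpace ℝ E] [NormedAddCommGroup F] [InnerProductSpace ℝ F]
    {n : WithTop ℕ∞} {u : X → E} {v : X → F} (hu : ContDiff ℝ n u) (hv : ContDiff ℝ n v) :
    ContDiff ℝ n fun x => epair (u x) (v x) :=
  (WithLp.prodContinuousLinearEquiv 2 ℝ E F).symm.contDiff.comp (hu.prodMk hv)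

theorem hasFDerivAt_unique_apply {X : Type*} [NormedAddCommGroup X] [NormedSpace ℝ X] {u : X → ℝ}
    {u₁ u₂ : X →L[ℝ] ℝ} {x : X} (h₁ : HasFDerivAt u u₁ x) (h₂ : HasFDerivAt u u₂ x) (v : X) :
    u₁ v = u₂ v := by
  rw [h₁.unique h₂]

theorem contDiff_of_inner {X : Type*} [NormedAddCommGroup X] [NormedSpace ℝ X] {n : ℕ}
    {k : WithTop ℕ∞} {u : X → RVec n} (h : ∀ v, ContDiff ℝ k fun x => inner ℝ (u x) v) :
    ContDiff ℝ k u := by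
  refine contDiff_euclidean.2 fun i => ?_
  simpa [EuclideanSpace.inner_single_right] using h (EuclideanSpace.single i 1)

/-! ### The lifted constraint system and its derivative -/

namespace BilevelData

variable {n₁ n₂ m : ℕ} (P : BilevelData n₁ n₂ m)

/-- The single-valued part of the feasibility mapping. -/
noncomputable def feasibilityFun (p : EProd (EProd (RVec n₁) (RVec n₂)) (RVec m)) :
    EProd (RVec n₁) (EProd (RVec n₂) (EProd (RVec m) (RVec m))) :=
  epair p.fst.fst
    (epair (P.gradY p.fst + P.jacT p.fst.snd p.snd) (epair (P.g p.fst.snd) p.snd))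

/-- The set of admissible values of the feasibility function. -/
def feasibilitySet : Set (EProd (RVec n₁) (EProd (RVec n₂) (EProd (RVec m) (RVec m)))) :=
  eprodSet P.S (eprodSet {0} (gph P.normalC))

theorem isClosed_feasibilitySet (hS : IsClosed P.S) : IsClosed P.feasibilitySet :=
  hS.eprodSet (isClosed_singleton.eprodSet
    (isClosed_gph_regularNormalCone P.C.toPointedCone.convex P.C.isClosed))

/-- Every residual G p - q with q ∈ Ω bounds dist(0, Υ(p)) from above; this puts subregularity into
the form needed for penalization. -/
theorem feasibilityFun_sub_mem {p : EProd (EProd (RVec n₁) (RVec n₂)) (RVec m)}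
    {q : EProd (RVec n₁) (EProd (RVec n₂) (EProd (RVec m) (RVec m)))}
    (hq : q ∈ P.feasibilitySet) : P.feasibilityFun p - q ∈ P.feasibilityMap p := by
  obtain ⟨hs, h0, hc⟩ := hq
  refine ⟨q.fst, hs, q.snd.snd, hc, ?_⟩
  have h0' : q.snd.fst = 0 := h0
  refine eprod_ext ?_ (eprod_ext ?_ rfl) <;> simp [feasibilityFun, h0']

theorem feasibilityFun_mem_iff {p : EProd (EProd (RVec n₁) (RVec n₂)) (RVec m)} :
    P.feasibilityFun p ∈ P.feasibilitySet ↔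
      p.fst.fst ∈ P.S ∧ p.snd ∈ P.multipliers p.fst := by
  simp [feasibilityFun, feasibilitySet, eprodSet, multipliers, gph, and_comm]

/-- The λ-component of a zero of Υ witnesses feasibility, so local minimality passes to the lifted
problem. -/
theorem fst_mem_feasibleSet {p : EProd (EProd (RVec n₁) (RVec n₂)) (RVec m)}
    (hp : epair 0 (epair 0 (epair 0 0)) ∈ P.feasibilityMap p) : p.fst ∈ P.feasibleSet := by
  obtain ⟨s, hs, q, hq, heq⟩ := hp
  have h1 : 0 = p.fst.fst - s := congrArg WithLp.fst heq
  have h2 : 0 = P.gradY p.fst + P.jacT p.fst.snd p.snd :=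
    congrArg (fun w => WithLp.fst (WithLp.snd w)) heq
  have h3 : epair 0 0 = epair (P.g p.fst.snd) p.snd - q :=
    congrArg (fun w => WithLp.snd (WithLp.snd w)) heq
  have h3' : q = epair (P.g p.fst.snd) p.snd := (sub_eq_zero.1 h3.symm).symm
  rw [h3'] at hq
  refine ⟨?_, Set.mem_iUnion₂.2 ⟨p.snd, hq, h2⟩⟩
  rwa [sub_eq_zero.1 h1.symm]

theorem inner_gradY (hj : ContDiff ℝ 2 P.j) (z : EProd (RVec n₁) (RVec n₂)) (v : RVec n₂) :
    inner ℝ (P.gradY z) v = fderiv ℝ P.j z (epair 0 v) := by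
  have hd : HasFDerivAt (fun y => epair z.fst y)
      (ContinuousLinearMap.comp (WithLp.prodContinuousLinearEquiv 2 ℝ (RVec n₁) (RVec n₂)).symm
        (ContinuousLinearMap.inr ℝ (RVec n₁) (RVec n₂)) : RVec n₂ →L[ℝ] _) z.snd :=
    (WithLp.prodContinuousLinearEquiv 2 ℝ (RVec n₁) (RVec n₂)).symm.hasFDerivAt.comp z.snd
      (hasFDerivAt_prodMk_right z.fst z.snd)
  have hz : HasFDerivAt P.j (fderiv ℝ P.j z) (epair z.fst z.snd) :=
    (hj.differentiable two_ne_zero z).hasFDerivAt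
  have h : HasFDerivAt (fun y => P.j (epair z.fst y)) _ z.snd := hz.comp z.snd hd
  rw [gradY, inner_gradient_left, h.fderiv]
  rfl

theorem inner_jacT (y v : RVec n₂) (lam : RVec m) :
    inner ℝ (P.jacT y lam) v = inner ℝ lam (fderiv ℝ P.g y v) :=
  ContinuousLinearMap.adjoint_inner_left _ _ _

theorem contDiff_gradY (hj : ContDiff ℝ 2 P.j) : ContDiff ℝ 1 P.gradY := by
  refine contDiff_of_inner fun v => ?_
  simp only [P.inner_gradY hj]
  exact (hj.fderiv_right (m := 1) (by norm_num)).clm_apply contDiff_const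

theorem contDiff_feasibilityFun (hj : ContDiff ℝ 2 P.j) (hg : ContDiff ℝ 2 P.g) :
    ContDiff ℝ 1 P.feasibilityFun := by
  have h1 : ContDiff ℝ 1 fun p : EProd (EProd (RVec n₁) (RVec n₂)) (RVec m) => p.fst :=
    (WithLp.fstL 2 ℝ (EProd (RVec n₁) (RVec n₂)) (RVec m)).contDiff
  have h2 : ContDiff ℝ 1 fun p : EProd (EProd (RVec n₁) (RVec n₂)) (RVec m) => p.snd :=
    (WithLp.sndL 2 ℝ (EProd (RVec n₁) (RVec n₂)) (RVec m)).contDiff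
  have h11 : ContDiff ℝ 1 fun p : EProd (EProd (RVec n₁) (RVec n₂)) (RVec m) => p.fst.fst :=
    (WithLp.fstL 2 ℝ (RVec n₁) (RVec n₂)).contDiff.comp h1
  have h12 : ContDiff ℝ 1 fun p : EProd (EProd (RVec n₁) (RVec n₂)) (RVec m) => p.fst.snd :=
    (WithLp.sndL 2 ℝ (RVec n₁) (RVec n₂)).contDiff.comp h1
  refine h11.epair ((((P.contDiff_gradY hj).comp h1).add (contDiff_of_inner fun v => ?_)).epair
    (((hg.of_le one_le_two).comp h12).epair h2))
  simp only [inner_jacT]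
  exact h2.inner ℝ (((hg.fderiv_right (m := 1) (by norm_num)).comp h12).clm_apply contDiff_const)

theorem inner_gradient_component (hg : ContDiff ℝ 2 P.g) (i : Fin m) (y v : RVec n₂) :
    inner ℝ (gradient (fun y' => P.g y' i) y) v = fderiv ℝ P.g y v i := by
  have h : HasFDerivAt (fun y' => P.g y' i)
      ((EuclideanSpace.proj (𝕜 := ℝ) i : RVec m →L[ℝ] ℝ).comp (fderiv ℝ P.g y)) y :=
    (EuclideanSpace.proj (𝕜 := ℝ) i : RVec m →L[ℝ] ℝ).hasFDerivAt.comp y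
      (hg.differentiable two_ne_zero y).hasFDerivAt
  rw [inner_gradient_left, h.fderiv]
  rfl

theorem hasFDerivAt_fderiv_apply (hg : ContDiff ℝ 2 P.g) (y v : RVec n₂) :
    HasFDerivAt (fun y' => fderiv ℝ P.g y' v)
      ((ContinuousLinearMap.apply ℝ (RVec m) v).comp (fderiv ℝ (fderiv ℝ P.g) y)) y := by
  have h : DifferentiableAt ℝ (fderiv ℝ P.g) y :=
    (hg.fderiv_right (m := 1) (by norm_num)).differentiable one_ne_zero y
  exact (ContinuousLinearMap.apply ℝ (RVec m) v).hasFDerivAt.comp y h.hasFDerivAt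

theorem inner_hessG (hg : ContDiff ℝ 2 P.g) (i : Fin m) (y ν v : RVec n₂) :
    inner ℝ (P.hessG i y ν) v = fderiv ℝ (fderiv ℝ P.g) y ν v i := by
  have hdiff : ContDiff ℝ 1 (gradient fun y' => P.g y' i) := by
    refine contDiff_of_inner fun v => ?_
    simp only [P.inner_gradient_component hg]
    exact contDiff_euclidean.1
      ((hg.fderiv_right (m := 1) (by norm_num)).clm_apply contDiff_const) i
  have h1 := (hdiff.differentiable one_ne_zero y).hasFDerivAt.inner ℝ (hasFDerivAt_const v y)
  simp only [P.inner_gradient_component hg] at h1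
  have h2 := (EuclideanSpace.proj (𝕜 := ℝ) i : RVec m →L[ℝ] ℝ).hasFDerivAt.comp y
    (P.hasFDerivAt_fderiv_apply hg y v)
  simpa [hessG] using DFunLike.congr_fun (h1.unique h2) ν

/-- Symmetry of the second derivative exchanges ν and v: differentiating y ↦ ∇g(y)ν along v produces
D²g(y)(v, ν). -/
theorem inner_sum_hessG (hg : ContDiff ℝ 2 P.g) (y ν v : RVec n₂) (lam : RVec m) :
    inner ℝ (∑ i, lam i • P.hessG i y ν) v = inner ℝ lam (fderiv ℝ (fderiv ℝ P.g) y v ν) := by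
  have hsymm := (hg.contDiffAt (x := y)).isSymmSndFDerivAt (by simp)
  rw [hsymm v ν, sum_inner, PiLp.inner_apply]
  refine Finset.sum_congr rfl fun i _ => ?_
  rw [inner_smul_left, P.inner_hessG hg]
  simp [mul_comm]

/-- The derivative of the feasibility function, paired with a multiplier. -/
theorem inner_fderiv_feasibilityFun (hj : ContDiff ℝ 2 P.j) (hg : ContDiff ℝ 2 P.g)
    (p v : EProd (EProd (RVec n₁) (RVec n₂)) (RVec m))
    (η : EProd (RVec n₁) (EProd (RVec n₂) (EProd (RVec m) (RVec m)))) :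
    inner ℝ η (fderiv ℝ P.feasibilityFun p v) = inner ℝ η.fst v.fst.fst
      + inner ℝ η.snd.fst (fderiv ℝ P.gradY p.fst v.fst)
      + (inner ℝ p.snd (fderiv ℝ (fderiv ℝ P.g) p.fst.snd v.fst.snd η.snd.fst)
        + inner ℝ v.snd (fderiv ℝ P.g p.fst.snd η.snd.fst))
      + inner ℝ η.snd.snd.fst (fderiv ℝ P.g p.fst.snd v.fst.snd)
      + inner ℝ η.snd.snd.snd v.snd := by
  obtain ⟨a₁, ha₁⟩ : ∃ a : EProd (EProd (RVec n₁) (RVec n₂)) (RVec m) →L[ℝ] EProd (RVec n₁) (RVec n₂),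
      ∀ q, a q = q.fst := ⟨WithLp.fstL 2 ℝ _ _, fun _ => rfl⟩
  obtain ⟨a₂, ha₂⟩ : ∃ a : EProd (EProd (RVec n₁) (RVec n₂)) (RVec m) →L[ℝ] RVec m,
      ∀ q, a q = q.snd := ⟨WithLp.sndL 2 ℝ _ _, fun _ => rfl⟩
  obtain ⟨b₁, hb₁⟩ : ∃ b : EProd (EProd (RVec n₁) (RVec n₂)) (RVec m) →L[ℝ] RVec n₁,
      ∀ q, b q = q.fst.fst := ⟨(WithLp.fstL 2 ℝ _ _).comp a₁, fun q => by simp [ha₁]⟩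
  obtain ⟨b₂, hb₂⟩ : ∃ b : EProd (EProd (RVec n₁) (RVec n₂)) (RVec m) →L[ℝ] RVec n₂,
      ∀ q, b q = q.fst.snd := ⟨(WithLp.sndL 2 ℝ _ _).comp a₁, fun q => by simp [ha₁]⟩
  -- Pairing with a fixed η moves the adjoint onto η, leaving ⟨λ, ∇g(y)ν⟩ with ν = `η.snd.fst`, to
  -- which the product rule applies.
  have heq : (fun q => inner ℝ η (P.feasibilityFun q)) = fun q => inner ℝ η.fst (b₁ q)
      + inner ℝ η.snd.fst (P.gradY (a₁ q)) + inner ℝ (a₂ q) (fderiv ℝ P.g (b₂ q) η.snd.fst)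
      + inner ℝ η.snd.snd.fst (P.g (b₂ q)) + inner ℝ η.snd.snd.snd (a₂ q) := by
    funext q
    have h : inner ℝ η.snd.fst (P.jacT q.fst.snd q.snd)
        = inner ℝ q.snd (fderiv ℝ P.g q.fst.snd η.snd.fst) := by
      rw [real_inner_comm, inner_jacT]
    simp only [ha₁, ha₂, hb₁, hb₂, feasibilityFun, WithLp.prod_inner_apply, WithLp.ofLp_fst,
      WithLp.ofLp_snd, inner_add_right, h]
    ring
  have hG := (hasFDerivAt_const η p).inner ℝ
    ((P.contDiff_feasibilityFun hj hg).differentiable one_ne_zero p).hasFDerivAt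
  have hgrad : HasFDerivAt (fun q => P.gradY (a₁ q)) ((fderiv ℝ P.gradY (a₁ p)).comp a₁) p :=
    ((P.contDiff_gradY hj).differentiable one_ne_zero (a₁ p)).hasFDerivAt.comp p a₁.hasFDerivAt
  have hval : HasFDerivAt (fun q => P.g (b₂ q)) ((fderiv ℝ P.g (b₂ p)).comp b₂) p :=
    (hg.differentiable two_ne_zero (b₂ p)).hasFDerivAt.comp p b₂.hasFDerivAt
  have hjac : HasFDerivAt (fun q => fderiv ℝ P.g (b₂ q) η.snd.fst) _ p :=
    (P.hasFDerivAt_fderiv_apply hg (b₂ p) η.snd.fst).comp p b₂.hasFDerivAt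
  have hsum := ((((hasFDerivAt_const η.fst p).inner ℝ b₁.hasFDerivAt).fun_add
    ((hasFDerivAt_const η.snd.fst p).inner ℝ hgrad)).fun_add
      (a₂.hasFDerivAt.inner ℝ hjac)).fun_add
        ((hasFDerivAt_const η.snd.snd.fst p).inner ℝ hval) |>.fun_add
          ((hasFDerivAt_const η.snd.snd.snd p).inner ℝ a₂.hasFDerivAt)
  rw [heq] at hG
  have := hasFDerivAt_unique_apply hG hsum v
  simpa only [ha₁, ha₂, hb₁, hb₂, ContinuousLinearMap.comp_apply, add_apply,
    ContinuousLinearMap.prod_apply, fderivInnerCLM_apply, zero_apply,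
    ContinuousLinearMap.apply_apply, inner_zero_left, add_zero] using this

end BilevelData

/-! ### M-stationarity -/

theorem corollary5p1 {n₁ n₂ m : ℕ} (P : BilevelData n₁ n₂ m)
    (hf : LocallyLipschitz P.f)
    (hS : IsClosed P.S)
    (hj : ContDiff ℝ 2 P.j)
    (hjconv : ∀ x : RVec n₁, ConvexOn ℝ Set.univ (fun y : RVec n₂ => P.j (epair x y)))
    (hg : ContDiff ℝ 2 P.g)
    (hgconv : ∀ y₁ y₂ : RVec n₂, ∀ α ∈ Set.Icc (0 : ℝ) 1,
      P.g (α • y₁ + (1 - α) • y₂) - α • P.g y₁ - (1 - α) • P.g y₂ ∈ P.C)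
    (x : RVec n₁) (y : RVec n₂)
    (hmin : P.IsLocalMinimizer (epair x y))
    (lam : RVec m) (hlam : lam ∈ P.multipliers (epair x y))
    (hsub : MetricallySubregularAt P.feasibilityMap (epair (epair x y) lam)
      (epair 0 (epair 0 (epair 0 0)))) :
    P.FullyExplicitlyMStationary (epair x y) lam := by
  obtain ⟨hfeas, hloc⟩ := hmin
  obtain ⟨κ, hκ, hsub⟩ := hsub
  have hG := P.contDiff_feasibilityFun hj hg
  set p₀ : EProd (EProd (RVec n₁) (RVec n₂)) (RVec m) := epair (epair x y) lam with hp₀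
  obtain ⟨M, r, hM, hr, hpen⟩ := exists_exact_penalty (p₀ := p₀) (Ω := P.feasibilitySet)
    (D := {p | epair 0 (epair 0 (epair 0 0)) ∈ P.feasibilityMap p}) hf
    hG.continuous.continuousAt hκ
    (by
      have hfst : Tendsto (fun p : EProd (EProd (RVec n₁) (RVec n₂)) (RVec m) => p.fst) (𝓝 p₀)
          (𝓝 (epair x y)) := (WithLp.fstL 2 ℝ _ _).continuous.tendsto p₀
      filter_upwards [hfst.eventually (eventually_nhdsWithin_iff.1 hloc)] with p hp hpD
      exact hp (P.fst_mem_feasibleSet hpD))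
    (by
      filter_upwards [hsub] with p hp q hq
      refine hp.trans ?_
      rw [ENNReal.ofReal_mul hκ.le]
      gcongr
      refine (Metric.infEDist_le_edist_of_mem (P.feasibilityFun_sub_mem hq)).trans_eq ?_
      have h0 : (epair 0 (epair 0 (epair 0 0)) :
        EProd (RVec n₁) (EProd (RVec n₂) (EProd (RVec m) (RVec m)))) = 0 := rfl
      rw [h0, edist_dist, dist_zero_left])
  obtain ⟨ξ, hξ, η, hη, heq⟩ := exists_multiplier (P.isClosed_feasibilitySet hS) hf hG
    (P.feasibilityFun_mem_iff (p := p₀) |>.2 ⟨hfeas.1, hlam⟩) hM hr hpen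
  obtain ⟨hσ, hη'⟩ := limitingNormalCone_eprodSet hη
  -- The discarded component is normal to {0}, which is no restriction: ν is free.
  obtain ⟨-, hμ⟩ := limitingNormalCone_eprodSet hη'
  have hpair : ∀ v : EProd (EProd (RVec n₁) (RVec n₂)) (RVec m),
      inner ℝ ξ v.fst + inner ℝ η (fderiv ℝ P.feasibilityFun p₀ v) = 0 := fun v => by
    have := congrArg (fun w => inner ℝ w v) heq
    simp only [inner_add_left, ContinuousLinearMap.adjoint_inner_left, inner_zero_left,
      WithLp.prod_inner_apply (epair ξ (0 : RVec m)), add_zero] at this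
    exact this
  simp only [P.inner_fderiv_feasibilityFun hj hg] at hpair
  -- Since f does not depend on λ, testing with (0, d) forces the last component to be -∇g(y)ν, the
  -- form required by the coderivative.
  have hsnd : η.snd.snd.snd = -fderiv ℝ P.g y η.snd.fst := by
    refine ext_inner_right ℝ fun d => ?_
    have := hpair (epair 0 d)
    simp [hp₀] at this
    rw [inner_neg_left]
    linarith [real_inner_comm d (fderiv ℝ P.g y η.snd.fst)]
  refine ⟨hfeas, hlam, η.snd.fst, ξ, hξ, η.snd.snd.fst, ?_, η.fst, hσ, ?_⟩
  · have h : epair η.snd.snd.fst (-fderiv ℝ P.g y η.snd.fst) = η.snd.snd := by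
      rw [← hsnd]
      rfl
    have hmem : epair η.snd.snd.fst (-fderiv ℝ P.g y η.snd.fst) ∈
        limitingNormalCone (gph P.normalC) (epair (P.g y) lam) := by
      rw [h]
      exact hμ
    exact hmem
  -- Testing with (v, 0) gives the stationarity equation in (x, y).
  · refine ext_inner_right ℝ fun v => ?_
    have := hpair (epair v 0)
    rw [WithLp.toLp_fst, WithLp.prod_inner_apply ξ v] at this
    simp only [inner_add_left, ContinuousLinearMap.adjoint_inner_left, inner_zero_left]
    simp only [WithLp.prod_inner_apply (epair _ _) v, P.inner_jacT, P.inner_sum_hessG hg,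
      inner_zero_left, zero_add, add_zero, WithLp.ofLp_fst, WithLp.ofLp_snd]
    simp only [hp₀, WithLp.toLp_fst, WithLp.toLp_snd, WithLp.ofLp_fst, WithLp.ofLp_snd,
      inner_zero_left, inner_zero_right, add_zero] at this ⊢
    linarith
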